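/- Let $\alpha<0$ be real. For $n\ge 3$ let $L_{\alpha,n}$ be the real symmetric $n\times n$ Laplacian matrix of the cycle on the vertices $1,\dots,n$ in which the edge joining $1$ and $n$ has weight $\alpha$ and all other edges have weight $1$; that is, $(L_{\alpha,n})_{1,1}=(L_{\alpha,n})_{n,n}=1+\alpha$, the other diagonal entries are $2$, the entries $(k,k+1)$ and $(k+1,k)$ with $1\le k\le n-1$ are $-1$, the entries $(1,n)$ and $(n,1)$ are $-\alpha$, and all remaining entries are $0$. Let $\lambda_{\alpha,n,1}\le\lambda_{\alpha,n,2}\le\dots\le\lambda_{\alpha,n,n}$ be its eigenvalues, counted with multiplicity. Put $$\varkappa_\alpha=\frac{\alpha-1}{\alpha},\qquad N_\alpha=\max\{3,\lfloor\varkappa_\alpha\rfloor+1\},\qquad \omega_\alpha=\log(1-2\alpha),\qquad d_{n,j}=\frac{(j-1)\pi}{n}.$$ Let $g\colon[0,\pi]\to[0,4]$, $g(x)=4\sin^2(x/2)$, and $g_-\colon[0,\infty)\to(-\infty,0]$, $g_-(x)=2-2\cosh x$; both maps are bijections. Let $\varphi_{\alpha,n}(x)=2\operatorname{artanh}\bigl(\varkappa_\alpha^{-1}\tanh(nx/2)\bigr)$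 for $x\ge 0$, and $\eta_\alpha(x)=2\arctan\bigl(\varkappa_\alpha\tan(x/2)\bigr)-\pi$ for $x\in[0,\pi)$, $\eta_\alpha(\pi)=0$. **Theorem (main equations).** Let $n\ge N_\alpha$. 1. The number $\lambda_{\alpha,n,1}$ belongs to the range of $g_-$, and $s_{\alpha,n}:=g_-^{-1}(\lambda_{\alpha,n,1})$ is the unique solution in $(0,\omega_\alpha)$ of the equation $x=\varphi_{\alpha,n}(x)$. 2. For every even $j$ with $4\le j\le n$, the number $\lambda_{\alpha,n,j}$ belongs to the range of $g$, and $z_{\alpha,n,j}:=g^{-1}(\lambda_{\alpha,n,j})$ is the unique solution in $[0,\pi]$ of the equation $x=d_{n,j}+\dfrac{\eta_\alpha(x)}{n}$. -/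

import Mathlib

namespace WeightedCycle

noncomputable section

/-- Laplacian matrix of the cyclic graph of order `n` (meant for `n ≥ 3`) with real weight `α` on
the edge between the first and the last vertex, and weight `1` on all other edges.
Vertices are indexed by `0, …, n - 1`. -/
def lapMatrix (α : ℝ) (n : ℕ) : Matrix (Fin n) (Fin n) ℝ := Matrix.of fun i j =>
  if i = j then
    (if i.val = 0 ∨ i.val + 1 = n then 1 + α else 2)
  else if i.val + 1 = j.val ∨ j.val + 1 = i.val then -1
  else if (i.val = 0 ∧ j.val + 1 = n) ∨ (j.val = 0 ∧ i.val + 1 = n) then -α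
  else 0

theorem lapMatrix_isHermitian (α : ℝ) (n : ℕ) : (lapMatrix α n).IsHermitian := by
  ext i j
  simp only [lapMatrix, Matrix.conjTranspose_apply, Matrix.of_apply, star_trivial]
  by_cases h : i = j
  · subst h; rfl
  · rw [if_neg h, if_neg (Ne.symm h)]
    simp only [or_comm]

/-- The `j`-th eigenvalue, `1 ≤ j ≤ n`, in increasing order and with multiplicities
(Mathlib's `eigenvalues₀` lists the eigenvalues in decreasing order, starting at index `0`). -/
def eigval (α : ℝ) (n j : ℕ) : ℝ :=
  if h : 1 ≤ j ∧ j ≤ n then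
    (lapMatrix_isHermitian α n).eigenvalues₀ ⟨n - j, by rw [Fintype.card_fin]; omega⟩
  else 0

/-- `ϰ_α`. -/
def kappa (α : ℝ) : ℝ := (α - 1) / α

/-- `N_α`. -/
def bigN (α : ℝ) : ℕ := max 3 (⌊kappa α⌋₊ + 1)

/-- `ω_α`. -/
def omega (α : ℝ) : ℝ := Real.log (1 - 2 * α)

/-- `d_{n,j}`. -/
def d (n j : ℕ) : ℝ := ((j : ℝ) - 1) * Real.pi / n

/-- `g`, to be considered on `[0, π]`. -/
def g (x : ℝ) : ℝ := 4 * Real.sin (x / 2) ^ 2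

/-- `g_-`, to be considered on `[0, ∞)`. -/
def gMinus (x : ℝ) : ℝ := 2 - 2 * Real.cosh x

/-- `z_{α,n,j}`: the preimage in `[0, π]` of the `j`-th eigenvalue under `g`. -/
def z (α : ℝ) (n j : ℕ) : ℝ :=
  Function.invFunOn g (Set.Icc 0 Real.pi) (eigval α n j)

/-- `s_{α,n}`: the preimage in `[0, ∞)` of the first eigenvalue under `g_-`. -/
def s (α : ℝ) (n : ℕ) : ℝ :=
  Function.invFunOn gMinus (Set.Ici 0) (eigval α n 1)

/-- `η_α` on `[0, π]`; at `x = π`, where `tan (x / 2) = +∞`, its value is the limit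
`2 * (π / 2) - π = 0`. -/
def eta (α x : ℝ) : ℝ :=
  if x = Real.pi then 0 else 2 * Real.arctan (kappa α * Real.tan (x / 2)) - Real.pi

/-- `φ_{α,n}` on `[0, ∞)`. -/
def phi (α : ℝ) (n : ℕ) (x : ℝ) : ℝ :=
  2 * Real.artanh ((kappa α)⁻¹ * Real.tanh (n * x / 2))

end

end WeightedCycle

/-! It suffices to exhibit `n` strictly increasing numbers, each with an explicit eigenvector: they
are then the whole sorted spectrum. Vectors symmetric under reversal of the vertices are cosines at
the odd grid points `d n j` and at `0`, whatever `α` is. Antisymmetric ones are sines, or one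
hyperbolic sine, centred at the midpoint; their boundary condition is the main equation. The
intermediate value theorem gives one negative eigenvalue and, for each even `j ≥ 4`, an angle
strictly between `d n (j - 1)` and `d n j`, so the list is ordered by interlacing. Uniqueness needs
no analysis of the equations: any solution yields an eigenvalue, hence a member of the list, and its
location fixes the index. -/

namespace WeightedCycle

/-! ### Sorted spectra from explicit eigenvectors -/

/-- Every eigenvalue of a Hermitian matrix occurs in the sorted list of its eigenvalues. -/
theorem exists_eigenvalues₀_eq {ι : Type*} [Fintype ι] [DecidableEq ι] {A : Matrix ι ι ℝ}
    (hA : A.IsHermitian) {l : ℝ} {v : ι → ℝ} (hv : v ≠ 0) (hvl : A.mulVec v = l • v) :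
    ∃ k, hA.eigenvalues₀ k = l := by
  have h1 : l ∈ spectrum ℝ A := by
    rw [← Matrix.spectrum_toLin', ← Module.End.hasEigenvalue_iff_mem_spectrum]
    exact Module.End.hasEigenvalue_of_hasEigenvector
      (x := v) ⟨Module.End.mem_eigenspace_iff.2 (by simpa using hvl), hv⟩
  rw [hA.spectrum_real_eq_range_eigenvalues] at h1
  obtain ⟨k, hk⟩ := h1
  exact ⟨_, hk⟩

open Matrix in
/-- Strictly decreasing eigenvalues, as many as the dimension, form the sorted list of
eigenvalues of a Hermitian matrix. -/
theorem eigenvalues₀_eq_of_strictAnti {ι : Type*} [Fintype ι] [DecidableEq ι] {A : Matrix ι ι ℝ}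
    (hA : A.IsHermitian) {μ : Fin (Fintype.card ι) → ℝ} (hμ : StrictAnti μ)
    (hev : ∀ i, ∃ v : ι → ℝ, v ≠ 0 ∧ A *ᵥ v = μ i • v) : hA.eigenvalues₀ = μ := by
  have hmem : ∀ i, ∃ k, hA.eigenvalues₀ k = μ i := by
    intro i
    obtain ⟨v, hv, hvA⟩ := hev i
    exact exists_eigenvalues₀_eq hA hv hvA
  choose σ hσ using hmem
  have hσb : Function.Bijective σ := Finite.injective_iff_bijective.1 fun a b h =>
    hμ.injective (by rw [← hσ a, ← hσ b, h])
  have hinj : Function.Injective hA.eigenvalues₀ := by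
    intro a b h
    obtain ⟨a, rfl⟩ := hσb.2 a
    obtain ⟨b, rfl⟩ := hσb.2 b
    rw [hσ, hσ] at h
    rw [hμ.injective h]
  -- A strictly decreasing finite list is determined by its range.
  rw [← (hA.eigenvalues₀_antitone.strictAnti_of_injective hinj).range_inj hμ]
  ext y
  constructor
  · rintro ⟨k, rfl⟩
    obtain ⟨i, rfl⟩ := hσb.2 k
    exact ⟨i, (hσ i).symm⟩
  · rintro ⟨i, rfl⟩
    exact ⟨σ i, hσ i⟩

theorem eigval_eq_of_strictMono {α : ℝ} {n : ℕ} {ν : ℕ → ℝ}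
    (hν : ∀ j k, 1 ≤ j → j < k → k ≤ n → ν j < ν k)
    (hev : ∀ j, 1 ≤ j → j ≤ n → ∃ v : Fin n → ℝ, v ≠ 0 ∧
      (lapMatrix α n).mulVec v = ν j • v) {j : ℕ} (h1 : 1 ≤ j) (hn : j ≤ n) :
    eigval α n j = ν j := by
  have hcard := Fintype.card_fin n
  have key := eigenvalues₀_eq_of_strictAnti (lapMatrix_isHermitian α n)
    (μ := fun i => ν (n - i.val))
    (fun a b h => hν _ _ (by omega) (by have : a.val < b.val := h; omega) (by omega))
    (fun i => hev _ (by omega) (by omega))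
  rw [eigval, dif_pos ⟨h1, hn⟩, key]
  simp only
  congr 1
  omega

/-- Source of uniqueness: the list leaves no room for further eigenvalues. -/
theorem exists_eq_of_mulVec_eq {α : ℝ} {n : ℕ} {ν : ℕ → ℝ}
    (hν : ∀ j k, 1 ≤ j → j < k → k ≤ n → ν j < ν k)
    (hev : ∀ j, 1 ≤ j → j ≤ n → ∃ v : Fin n → ℝ, v ≠ 0 ∧
      (lapMatrix α n).mulVec v = ν j • v) {l : ℝ} {v : Fin n → ℝ} (hv : v ≠ 0)
    (hvl : (lapMatrix α n).mulVec v = l • v) : ∃ j, 1 ≤ j ∧ j ≤ n ∧ l = ν j := by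
  have hA := lapMatrix_isHermitian α n
  obtain ⟨k, rfl⟩ := exists_eigenvalues₀_eq hA hv hvl
  have hcard := Fintype.card_fin n
  rw [eigenvalues₀_eq_of_strictAnti hA
    (μ := fun i => ν (n - i.val))
    (fun a b h => hν _ _ (by omega) (by have : a.val < b.val := h; omega) (by omega))
    (fun i => hev _ (by omega) (by omega))]
  exact ⟨_, by omega, by omega, rfl⟩

/-! ### Eigenvectors from the three-term recurrence -/

theorem sum_three_ite {ι : Type*} [Fintype ι] [DecidableEq ι] (p q r : ι) (a b c : ℝ)
    (v : ι → ℝ) : ∑ j, ((if j = p then a else 0) + (if j = q then b else 0) +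
      (if j = r then c else 0)) * v j = a * v p + b * v q + c * v r := by
  simp [add_mul, Finset.sum_add_distrib]

/-- A solution of the three-term recurrence that satisfies the two boundary conditions restricts
to a solution of the eigenvalue equation. -/
theorem lapMatrix_mulVec_eq {α : ℝ} {n : ℕ} (hn : 3 ≤ n) {l : ℝ} {f : ℝ → ℝ}
    (hrec : ∀ x, f (x - 1) + f (x + 1) = (2 - l) * f x)
    (hl : f (-1) - f 0 + α * (f 0 - f (n - 1)) = 0)
    (hr : f n - f (n - 1) + α * (f (n - 1) - f 0) = 0) :
    (lapMatrix α n).mulVec (fun i => f i.val) = l • fun i : Fin n => f i.val := by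
  have hn1 : ((n - 1 : ℕ) : ℝ) = n - 1 := by rw [Nat.cast_sub (by omega)]; simp
  ext i
  simp only [Matrix.mulVec, dotProduct, Pi.smul_apply, smul_eq_mul]
  have hi := i.isLt
  rcases Nat.eq_zero_or_pos i.val with h0 | h0
  · have hrow : ∀ j, lapMatrix α n i j = (if j = i then 1 + α else 0) +
        (if j = ⟨1, by omega⟩ then -1 else 0) + (if j = ⟨n - 1, by omega⟩ then -α else 0) := by
      intro j
      simp only [lapMatrix, Matrix.of_apply, Fin.ext_iff]
      have hj := j.isLt
      rcases (by omega : j.val = 0 ∨ j.val = 1 ∨ j.val + 1 = n ∨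
        (j.val ≠ 0 ∧ j.val ≠ 1 ∧ j.val + 1 ≠ n)) with h | h | h | h <;>
      grind
    simp only [hrow, sum_three_ite]
    -- Subtracting the recurrence at `0`, with its ghost value `f (-1)`, from the first row leaves
    -- exactly `hl`.
    have := hrec 0
    simp only [h0, hn1, Nat.cast_one, Nat.cast_zero]
    norm_num at this
    linarith
  rcases (by omega : i.val + 1 = n ∨ i.val + 1 < n) with h1 | h1
  · have hrow : ∀ j, lapMatrix α n i j = (if j = i then 1 + α else 0) +
        (if j = ⟨n - 2, by omega⟩ then -1 else 0) + (if j = ⟨0, by omega⟩ then -α else 0) := by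
      intro j
      simp only [lapMatrix, Matrix.of_apply, Fin.ext_iff]
      have hj := j.isLt
      rcases (by omega : j.val = 0 ∨ j.val + 2 = n ∨ j.val + 1 = n ∨
        (j.val ≠ 0 ∧ j.val + 2 ≠ n ∧ j.val + 1 ≠ n)) with h | h | h | h <;>
      grind
    simp only [hrow, sum_three_ite]
    have := hrec (n - 1)
    have hi1 : (i.val : ℝ) = n - 1 := by
      rw [eq_sub_iff_add_eq]; exact_mod_cast h1
    have hn2 : ((n - 2 : ℕ) : ℝ) = n - 1 - 1 := by
      rw [Nat.cast_sub (by omega)]; push_cast; ring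
    simp only [hi1, hn2, Nat.cast_zero]
    rw [sub_add_cancel] at this
    linarith
  · have hrow : ∀ j, lapMatrix α n i j = (if j = i then 2 else 0) +
        (if j = ⟨i.val - 1, by omega⟩ then -1 else 0) +
        (if j = ⟨i.val + 1, by omega⟩ then -1 else 0) := by
      intro j
      simp only [lapMatrix, Matrix.of_apply, Fin.ext_iff]
      have hj := j.isLt
      rcases (by omega : j.val = i.val ∨ j.val + 1 = i.val ∨ j.val = i.val + 1 ∨
        (j.val ≠ i.val ∧ j.val + 1 ≠ i.val ∧ j.val ≠ i.val + 1)) with h | h | h | h <;>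
      grind
    simp only [hrow, sum_three_ite]
    have := hrec i.val
    have hi1 : ((i.val - 1 : ℕ) : ℝ) = i.val - 1 := by rw [Nat.cast_sub (by omega)]; simp
    simp only [hi1, Nat.cast_add, Nat.cast_one]
    linarith

theorem g_eq_two_sub (x : ℝ) : g x = 2 - 2 * Real.cos x := by
  have h := Real.cos_sq (x / 2)
  have h1 := Real.sin_sq_add_cos_sq (x / 2)
  rw [mul_div_cancel₀ x two_ne_zero] at h
  rw [g]
  linarith

theorem g_strictMonoOn : StrictMonoOn g (Set.Icc 0 Real.pi) := by
  intro x hx y hy hxy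
  rw [g_eq_two_sub, g_eq_two_sub]
  have := Real.strictAntiOn_cos hx hy hxy
  linarith

theorem gMinus_injOn : Set.InjOn gMinus (Set.Ici 0) := by
  intro x hx y hy hxy
  simp only [gMinus] at hxy
  exact Real.cosh_strictMonoOn.injOn hx hy (by linarith)

theorem gMinus_neg {x : ℝ} (hx : 0 < x) : gMinus x < 0 := by
  have := Real.one_lt_cosh.2 hx.ne'
  rw [gMinus]
  linarith

theorem restrict_ne_zero {n : ℕ} (hn : 3 ≤ n) {f : ℝ → ℝ} (hf : f 0 ≠ 0) :
    (fun i : Fin n => f i.val) ≠ 0 := fun h => hf (by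
  have := congrFun h ⟨0, by omega⟩
  simpa using this)

/-- The phase `1 / 2` and the period give `f (-1) = f 0 = f (n - 1) = f n`, so the edge of weight
`α` contributes nothing. -/
theorem exists_eigenvector_cos (α : ℝ) {n : ℕ} (hn : 3 ≤ n) {θ : ℝ} (h0 : 0 ≤ θ)
    (hπ : θ < Real.pi) (m : ℕ) (hθ : n * θ = m * (2 * Real.pi)) :
    ∃ v : Fin n → ℝ, v ≠ 0 ∧ (lapMatrix α n).mulVec v = g θ • v := by
  set f : ℝ → ℝ := fun x => Real.cos ((x + 1 / 2) * θ) with hf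
  have hf0 : f 0 = Real.cos (θ / 2) := by simp only [hf]; congr 1; ring
  have e1 : f (-1) = f 0 := by
    rw [hf0, ← Real.cos_neg (θ / 2)]; simp only [hf]; congr 1; ring
  have e2 : f n = f 0 := by
    rw [hf0, ← Real.cos_add_nat_mul_two_pi _ m, ← hθ]; simp only [hf]; congr 1; ring
  have e3 : f (n - 1) = f 0 := by
    rw [hf0, ← Real.cos_neg (θ / 2), ← Real.cos_add_nat_mul_two_pi _ m, ← hθ]
    simp only [hf]; congr 1; ring
  refine ⟨_, restrict_ne_zero hn (f := f) ?_, lapMatrix_mulVec_eq hn (f := f) ?_ ?_ ?_⟩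
  · rw [hf0]
    exact (Real.cos_pos_of_mem_Ioo ⟨by linarith [Real.pi_pos], by linarith⟩).ne'
  · intro x
    rw [g_eq_two_sub]
    simp only [hf]
    rw [show (x - 1 + 1 / 2) * θ = (x + 1 / 2) * θ - θ by ring,
      show (x + 1 + 1 / 2) * θ = (x + 1 / 2) * θ + θ by ring, Real.cos_sub, Real.cos_add]
    ring
  · rw [e1, e3]; ring
  · rw [e2, e3]; ring

/-- A sine centred at `(n - 1) / 2` is odd under reversal, so both boundary conditions reduce to
`hθ`. -/
theorem exists_eigenvector_sin {α : ℝ} {n : ℕ} (hn : 3 ≤ n) {θ : ℝ} (h0 : 0 < θ)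
    (hπ : θ < Real.pi)
    (hθ : Real.sin ((n + 1) / 2 * θ) = (1 - 2 * α) * Real.sin ((n - 1) / 2 * θ)) :
    ∃ v : Fin n → ℝ, v ≠ 0 ∧ (lapMatrix α n).mulVec v = g θ • v := by
  set f : ℝ → ℝ := fun x => Real.sin ((x - (n - 1) / 2) * θ) with hf
  have hf0 : f 0 = -Real.sin ((n - 1) / 2 * θ) := by
    rw [← Real.sin_neg]; simp only [hf]; congr 1; ring
  have e1 : f (-1) = -Real.sin ((n + 1) / 2 * θ) := by
    rw [← Real.sin_neg]; simp only [hf]; congr 1; ring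
  have e2 : f n = Real.sin ((n + 1) / 2 * θ) := by simp only [hf]; congr 1; ring
  have e3 : f (n - 1) = Real.sin ((n - 1) / 2 * θ) := by simp only [hf]; congr 1; ring
  refine ⟨_, restrict_ne_zero hn (f := f) ?_, lapMatrix_mulVec_eq hn (f := f) ?_ ?_ ?_⟩
  · rw [hf0, neg_ne_zero]
    -- If `f 0` vanished, `hθ` and the addition formula would make sine and cosine vanish at the
    -- same point.
    intro h
    have hs := Real.sin_pos_of_pos_of_lt_pi h0 hπ
    rw [h, show (n + 1 : ℝ) / 2 * θ = (n - 1) / 2 * θ + θ by ring, Real.sin_add, h] at hθ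
    have hc : Real.cos ((n - 1) / 2 * θ) = 0 := by
      have : Real.cos ((n - 1) / 2 * θ) * Real.sin θ = 0 := by linarith
      exact (mul_eq_zero.1 this).resolve_right hs.ne'
    have := Real.sin_sq_add_cos_sq ((n - 1) / 2 * θ)
    rw [h, hc] at this
    norm_num at this
  · intro x
    rw [g_eq_two_sub]
    simp only [hf]
    rw [show (x - 1 - (n - 1) / 2) * θ = (x - (n - 1) / 2) * θ - θ by ring,
      show (x + 1 - (n - 1) / 2) * θ = (x - (n - 1) / 2) * θ + θ by ring, Real.sin_sub,
      Real.sin_add]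
    ring
  · rw [e1, e3, hf0, hθ]; ring
  · rw [e2, e3, hf0, hθ]; ring

theorem exists_eigenvector_sinh {α : ℝ} {n : ℕ} (hn : 3 ≤ n) {x : ℝ} (h0 : 0 < x)
    (hx : Real.sinh ((n + 1) / 2 * x) = (1 - 2 * α) * Real.sinh ((n - 1) / 2 * x)) :
    ∃ v : Fin n → ℝ, v ≠ 0 ∧ (lapMatrix α n).mulVec v = gMinus x • v := by
  have hn' : (3 : ℝ) ≤ n := by exact_mod_cast hn
  set f : ℝ → ℝ := fun t => Real.sinh ((t - (n - 1) / 2) * x) with hf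
  have hf0 : f 0 = -Real.sinh ((n - 1) / 2 * x) := by
    rw [← Real.sinh_neg]; simp only [hf]; congr 1; ring
  have e1 : f (-1) = -Real.sinh ((n + 1) / 2 * x) := by
    rw [← Real.sinh_neg]; simp only [hf]; congr 1; ring
  have e2 : f n = Real.sinh ((n + 1) / 2 * x) := by simp only [hf]; congr 1; ring
  have e3 : f (n - 1) = Real.sinh ((n - 1) / 2 * x) := by simp only [hf]; congr 1; ring
  refine ⟨_, restrict_ne_zero hn (f := f) ?_, lapMatrix_mulVec_eq hn (f := f) ?_ ?_ ?_⟩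
  · rw [hf0, neg_ne_zero]
    exact (Real.sinh_pos_iff.2 (mul_pos (by linarith) h0)).ne'
  · intro t
    rw [gMinus]
    simp only [hf]
    rw [show (t - 1 - (n - 1) / 2) * x = (t - (n - 1) / 2) * x - x by ring,
      show (t + 1 - (n - 1) / 2) * x = (t - (n - 1) / 2) * x + x by ring, Real.sinh_sub,
      Real.sinh_add]
    ring
  · rw [e1, e3, hf0, hx]; ring
  · rw [e2, e3, hf0, hx]; ring

/-! ### Main equations as boundary conditions -/

theorem one_lt_kappa {α : ℝ} (hα : α < 0) : 1 < kappa α := by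
  rw [kappa, sub_div, div_self hα.ne]
  have := div_neg_of_pos_of_neg one_pos hα
  linarith

theorem alpha_mul_kappa {α : ℝ} (hα : α < 0) : α * kappa α = α - 1 :=
  mul_div_cancel₀ _ hα.ne

theorem inv_kappa_mul_tanh_mem {α : ℝ} (hα : α < 0) (t : ℝ) :
    (kappa α)⁻¹ * Real.tanh t ∈ Set.Ioo (-1 : ℝ) 1 := by
  have hk := one_lt_kappa hα
  have : |(kappa α)⁻¹ * Real.tanh t| < 1 := by
    rw [abs_mul, abs_of_pos (inv_pos.2 (by linarith))]
    have h1 := Real.abs_tanh_lt_one t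
    have h2 : (kappa α)⁻¹ < 1 := inv_lt_one_of_one_lt₀ hk
    have h3 : 0 < (kappa α)⁻¹ := inv_pos.2 (by linarith)
    nlinarith [abs_nonneg (Real.tanh t)]
  exact abs_lt.1 this

/-- Both sides say `tanh (n x / 2) = ϰ tanh (x / 2)`; clear denominators and use `α ϰ = α - 1`. -/
theorem eq_phi_iff {α : ℝ} (hα : α < 0) (n : ℕ) (x : ℝ) :
    x = phi α n x ↔
      Real.sinh ((n + 1) / 2 * x) = (1 - 2 * α) * Real.sinh ((n - 1) / 2 * x) := by
  have hk := one_lt_kappa hα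
  have hc1 := Real.cosh_pos (n * x / 2)
  have hc2 := Real.cosh_pos (x / 2)
  have h1 : x = phi α n x ↔ Real.tanh (n * x / 2) = kappa α * Real.tanh (x / 2) := by
    rw [← inv_mul_eq_iff_eq_mul₀ (by linarith), phi]
    constructor
    · intro h
      rw [← Real.tanh_artanh (inv_kappa_mul_tanh_mem hα (n * x / 2))]
      congr 1
      linarith
    · intro h
      rw [h, Real.artanh_tanh]
      ring
  rw [h1, Real.tanh_eq_sinh_div_cosh, Real.tanh_eq_sinh_div_cosh, ← mul_div_assoc,
    div_eq_div_iff hc1.ne' hc2.ne', show (n + 1 : ℝ) / 2 * x = n * x / 2 + x / 2 by ring,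
    show (n - 1 : ℝ) / 2 * x = n * x / 2 - x / 2 by ring, Real.sinh_add, Real.sinh_sub,
    ← mul_right_inj' (mul_ne_zero two_ne_zero hα.ne)]
  have hak := alpha_mul_kappa hα
  constructor
  · intro h
    linear_combination h +
      2 * Real.sinh (x / 2) * Real.cosh (n * x / 2) * hak
  · intro h
    linear_combination h -
      2 * Real.sinh (x / 2) * Real.cosh (n * x / 2) * hak

theorem sin_eq_of_eq_eta {α : ℝ} (hα : α < 0) {n : ℕ} (hn : n ≠ 0) {x : ℝ} (h0 : 0 < x)
    (hπ : x < Real.pi) (m : ℕ) (hx : x = d n (2 * m + 2) + eta α x / n) :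
    Real.sin ((n + 1) / 2 * x) = (1 - 2 * α) * Real.sin ((n - 1) / 2 * x) := by
  have hn' : (n : ℝ) ≠ 0 := by exact_mod_cast hn
  have hk := one_lt_kappa hα
  have hc2 : 0 < Real.cos (x / 2) := Real.cos_pos_of_mem_Ioo ⟨by linarith, by linarith⟩
  set a := Real.arctan (kappa α * Real.tan (x / 2)) with ha
  have hca : 0 < Real.cos a := Real.cos_arctan_pos _
  -- For an even index the `-π` in `eta` leaves a whole multiple of `2π`.
  have hnx : n * x / 2 = a + m * Real.pi := by
    rw [eta, if_neg hπ.ne, ← ha, d] at hx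
    field_simp at hx
    push_cast at hx
    linarith
  have hta : Real.sin a * Real.cos (x / 2) = kappa α * Real.sin (x / 2) * Real.cos a := by
    have := Real.tan_arctan (kappa α * Real.tan (x / 2))
    rw [← ha, Real.tan_eq_sin_div_cos, Real.tan_eq_sin_div_cos, ← mul_div_assoc,
      div_eq_div_iff hca.ne' hc2.ne'] at this
    exact this
  have hak := alpha_mul_kappa hα
  rw [show (n + 1 : ℝ) / 2 * x = n * x / 2 + x / 2 by ring,
    show (n - 1 : ℝ) / 2 * x = n * x / 2 - x / 2 by ring, Real.sin_add, Real.sin_sub, hnx,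
    Real.sin_add_nat_mul_pi, Real.cos_add_nat_mul_pi]
  linear_combination (-1) ^ m * (2 * α * hta +
      2 * Real.sin (x / 2) * Real.cos a * hak)

theorem eta_mem_Ioo {α : ℝ} (hα : α < 0) {x : ℝ} (h0 : 0 < x) (hπ : x < Real.pi) :
    eta α x ∈ Set.Ioo (-Real.pi) 0 := by
  rw [eta, if_neg hπ.ne]
  have hk := one_lt_kappa hα
  have h1 := Real.arctan_lt_pi_div_two (kappa α * Real.tan (x / 2))
  have h2 : 0 < Real.arctan (kappa α * Real.tan (x / 2)) :=
    Real.arctan_pos.2 (mul_pos (by linarith)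
      (Real.tan_pos_of_pos_of_lt_pi_div_two (by linarith) (by linarith)))
  constructor <;> linarith

/-! ### Localization and existence of solutions -/

theorem d_lt_pi {n j : ℕ} (hn : 0 < n) (hj : j ≤ n) : d n j < Real.pi := by
  have hn' : (0 : ℝ) < n := by exact_mod_cast hn
  have hj' : (j : ℝ) ≤ n := by exact_mod_cast hj
  rw [d, div_lt_iff₀ hn']
  nlinarith [Real.pi_pos]

theorem d_succ (n j : ℕ) : d n (j + 1) = d n j + Real.pi / n := by
  rw [d, d]; push_cast; ring

theorem d_mono (n : ℕ) : Monotone (d n) := by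
  intro j k h
  have hj' : (j : ℝ) ≤ k := by exact_mod_cast h
  have := Real.pi_pos
  simp only [d]
  gcongr

/-- Solutions of the equation for `z` lie strictly between neighbouring grid points. -/
theorem mem_Ioo_of_eq_eta {α : ℝ} (hα : α < 0) {n j : ℕ} (hj : 3 ≤ j) (hjn : j + 1 ≤ n) {x : ℝ}
    (h0 : 0 ≤ x) (hπ : x ≤ Real.pi) (hx : x = d n (j + 1) + eta α x / n) :
    x ∈ Set.Ioo (d n j) (d n (j + 1)) := by
  have hn0 : 0 < n := by omega
  have hn' : (0 : ℝ) < n := by exact_mod_cast hn0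
  have hd := d_lt_pi hn0 hjn
  have hs := d_succ n j
  have hdj : 0 < d n j := by
    have : (3 : ℝ) ≤ j := by exact_mod_cast hj
    exact div_pos (mul_pos (by linarith) Real.pi_pos) hn'
  have hxπ : x < Real.pi := by
    rcases hπ.eq_or_lt with h | h
    · rw [eta, if_pos h, zero_div, add_zero] at hx
      linarith
    · exact h
  have hx0 : 0 < x := by
    -- Since `eta α 0 = -π`, at `x = 0` the equation reads `0 = d n j`; this would hold for `j = 1`.
    rcases h0.eq_or_lt with h | h
    · rw [eta, if_neg hxπ.ne, ← h] at hx
      simp only [zero_div, Real.tan_zero, mul_zero, Real.arctan_zero, zero_sub, neg_div] at hx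
      linarith
    · exact h
  obtain ⟨h1, h2⟩ := eta_mem_Ioo hα hx0 hxπ
  have h3 : eta α x / n < 0 := div_neg_of_neg_of_pos h2 hn'
  have h4 : -Real.pi / n < eta α x / n := by gcongr
  rw [neg_div] at h4
  constructor <;> linarith

theorem exists_eq_eta {α : ℝ} (hα : α < 0) {n j : ℕ} (hj : 3 ≤ j) (hjn : j + 1 ≤ n) :
    ∃ x ∈ Set.Ioo (d n j) (d n (j + 1)), x = d n (j + 1) + eta α x / n := by
  have hn0 : 0 < n := by omega
  have hn' : (0 : ℝ) < n := by exact_mod_cast hn0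
  have hd := d_lt_pi hn0 hjn
  have hs := d_succ n j
  have hpn : 0 < Real.pi / n := div_pos Real.pi_pos hn'
  have hdj : 0 < d n j := by
    have : (3 : ℝ) ≤ j := by exact_mod_cast hj
    exact div_pos (mul_pos (by linarith) Real.pi_pos) hn'
  have hcont : ContinuousOn (fun x => x - (d n (j + 1) +
      (2 * Real.arctan (kappa α * Real.tan (x / 2)) - Real.pi) / n))
      (Set.Icc (d n j) (d n (j + 1))) := by
    have : ContinuousOn (fun x => Real.tan (x / 2)) (Set.Icc (d n j) (d n (j + 1))) := by
      intro x hx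
      have hc : Real.cos (x / 2) ≠ 0 := (Real.cos_pos_of_mem_Ioo
        ⟨by linarith [hx.1], by linarith [hx.2]⟩).ne'
      exact ((Real.continuousAt_tan.2 hc).comp
        (f := fun x : ℝ => x / 2) (by fun_prop)).continuousWithinAt
    have h2 := Real.continuous_arctan.comp_continuousOn (continuousOn_const.mul this
      (f := fun _ => kappa α))
    exact continuousOn_id.sub (continuousOn_const.add
      (((continuousOn_const.mul h2).sub continuousOn_const).div_const _))
  have hη : ∀ x, d n j ≤ x → x ≤ d n (j + 1) →
      2 * Real.arctan (kappa α * Real.tan (x / 2)) - Real.pi = eta α x := by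
    intro x _ h2
    rw [eta, if_neg (by linarith)]
  have hle : d n j ≤ d n (j + 1) := by linarith
  have ha : d n j - (d n (j + 1) +
      (2 * Real.arctan (kappa α * Real.tan (d n j / 2)) - Real.pi) / n) ≤ 0 := by
    rw [hη _ le_rfl hle]
    have := (eta_mem_Ioo hα hdj (by linarith)).1
    have h4 : -Real.pi / n < eta α (d n j) / n := by gcongr
    rw [neg_div] at h4
    linarith
  have hb : 0 ≤ d n (j + 1) - (d n (j + 1) +
      (2 * Real.arctan (kappa α * Real.tan (d n (j + 1) / 2)) - Real.pi) / n) := by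
    rw [hη _ hle le_rfl]
    have := (eta_mem_Ioo hα (by linarith) hd).2
    have h4 : eta α (d n (j + 1)) / n < 0 := div_neg_of_neg_of_pos this hn'
    linarith
  obtain ⟨x, hx, hx0⟩ := intermediate_value_Icc hle hcont ⟨ha, hb⟩
  simp only [hη x hx.1 hx.2] at hx0
  have hx1 : x = d n (j + 1) + eta α x / n := by linarith
  exact ⟨x, mem_Ioo_of_eq_eta hα hj hjn (by linarith [hx.1]) (by linarith [hx.2]) hx1, hx1⟩

theorem omega_pos {α : ℝ} (hα : α < 0) : 0 < omega α := Real.log_pos (by linarith)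

theorem exists_eq_phi {α : ℝ} (hα : α < 0) {n : ℕ} (hn : bigN α ≤ n) :
    ∃ x ∈ Set.Ioo 0 (omega α), x = phi α n x := by
  have hω := omega_pos hα
  have hn3 : 3 ≤ n := le_trans (le_max_left _ _) hn
  have hn' : (3 : ℝ) ≤ n := by exact_mod_cast hn3
  have hκ : kappa α < n := by
    refine (Nat.lt_floor_add_one _).trans_le ?_
    exact_mod_cast le_trans (le_max_right _ _) hn
  have hak := alpha_mul_kappa hα
  set F : ℝ → ℝ := fun x =>
    Real.sinh ((n + 1) / 2 * x) - (1 - 2 * α) * Real.sinh ((n - 1) / 2 * x) with hF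
  have hFc : Continuous F :=
    (Real.continuous_sinh.comp (continuous_const.mul continuous_id)).sub
      (continuous_const.mul (Real.continuous_sinh.comp (continuous_const.mul continuous_id)))
  have hd : HasDerivAt F (1 + α * (n - 1)) 0 := by
    have h1 : ∀ c : ℝ, HasDerivAt (fun x : ℝ => Real.sinh (c * x)) c 0 := by
      intro c
      have := ((hasDerivAt_id (0 : ℝ)).const_mul c).sinh
      simpa using this
    have := (h1 ((n + 1) / 2)).sub ((h1 ((n - 1) / 2)).const_mul (1 - 2 * α))
    refine this.congr_deriv ?_
    ring
  -- Equivalent to `ϰ < n`: this is the role of `bigN`. It makes `F` negative just to the right of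
  -- its trivial zero.
  have hdneg : 1 + α * (n - 1) < 0 := by nlinarith
  have hF0 : F 0 = 0 := by simp [hF]
  obtain ⟨ε, hε, hεneg⟩ : ∃ ε ∈ Set.Ioo 0 (omega α), F ε < 0 := by
    have h1 := (hasDerivAt_iff_tendsto_slope.1 hd).eventually (gt_mem_nhds hdneg)
    have h2 : ∀ᶠ y in nhdsWithin 0 (Set.Ioi 0), slope F 0 y < 0 :=
      h1.filter_mono (nhdsWithin_mono _ fun y (hy : y ∈ Set.Ioi (0 : ℝ)) =>
        Set.mem_compl_singleton_iff.2 (Set.mem_Ioi.1 hy).ne')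
    obtain ⟨ε, hε1, hε2⟩ := (h2.and (Ioo_mem_nhdsGT hω)).exists
    refine ⟨ε, hε2, ?_⟩
    rw [slope_def_field, hF0, sub_zero, sub_zero, div_neg_iff] at hε1
    rcases hε1 with h | h
    · linarith [hε2.1, h.2]
    · exact h.1
  -- As `exp ω = 1 - 2α`, here `F ω = sinh ω (cosh A - sinh A)` with `A = (n - 1) ω / 2`.
  have hFω : 0 < F (omega α) := by
    have he : 1 - 2 * α = Real.cosh (omega α) + Real.sinh (omega α) := by
      rw [Real.cosh_add_sinh, omega, Real.exp_log (by linarith)]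
    simp only [hF]
    rw [show (n + 1 : ℝ) / 2 * omega α = (n - 1) / 2 * omega α + omega α by ring,
      Real.sinh_add, he]
    have h1 := Real.sinh_lt_cosh ((n - 1) / 2 * omega α)
    have h2 := Real.sinh_pos_iff.2 hω
    nlinarith
  obtain ⟨x, hx, hx0⟩ := intermediate_value_Ioo hε.2.le hFc.continuousOn ⟨hεneg, hFω⟩
  exact ⟨x, ⟨hε.1.trans hx.1, hx.2⟩, (eq_phi_iff hα n x).2 (by simp only [hF] at hx0; linarith)⟩

/-- Angles `θ j`, interlacing with the grid, that parametrize all eigenvalues but the first. -/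
theorem exists_angles {α : ℝ} (hα : α < 0) {n : ℕ} (hn : 3 ≤ n) :
    ∃ θ : ℕ → ℝ, (∀ j, 3 ≤ j → j ≤ n → d n (j - 1) < θ j) ∧
      (∀ j, 2 ≤ j → j ≤ n → 0 ≤ θ j ∧ θ j ≤ d n j) ∧
      (∀ j, Even j → 4 ≤ j → j ≤ n → θ j = d n j + eta α (θ j) / n) ∧
      ∀ j, 2 ≤ j → j ≤ n → ∃ v : Fin n → ℝ, v ≠ 0 ∧
        (lapMatrix α n).mulVec v = g (θ j) • v := by
  have hn' : (0 : ℝ) < n := by exact_mod_cast (by omega : 0 < n)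
  have hpn : 0 < Real.pi / n := div_pos Real.pi_pos hn'
  have hd0 : ∀ j, 1 ≤ j → 0 ≤ d n j := fun j hj => by
    simpa [d] using d_mono n hj
  have key : ∀ j, ∃ t, (3 ≤ j → j ≤ n → d n (j - 1) < t) ∧
      (2 ≤ j → j ≤ n → 0 ≤ t ∧ t ≤ d n j) ∧
      (Even j → 4 ≤ j → j ≤ n → t = d n j + eta α t / n) ∧
      (2 ≤ j → j ≤ n → ∃ v : Fin n → ℝ, v ≠ 0 ∧ (lapMatrix α n).mulVec v = g t • v) := by
    intro j
    by_cases hj : 2 ≤ j ∧ j ≤ n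
    swap
    · exact ⟨0, fun _ _ => by omega, fun _ _ => by omega, fun _ _ _ => by omega,
        fun _ _ => by omega⟩
    obtain ⟨h2, hjn⟩ := hj
    rcases Nat.even_or_odd' j with ⟨m, rfl | rfl⟩
    · rcases (by omega : m = 1 ∨ 2 ≤ m) with rfl | hm
      -- Index `2` is the constant vector, with eigenvalue `0`.
      · refine ⟨0, fun _ _ => by omega, fun _ _ => ⟨le_rfl, hd0 _ (by omega)⟩, fun _ _ _ => by omega,
          fun _ _ => exists_eigenvector_cos α hn le_rfl Real.pi_pos 0 (by simp)⟩
      · obtain ⟨k, rfl⟩ : ∃ k, m = k + 1 := ⟨m - 1, by omega⟩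
        obtain ⟨x, ⟨hx1, hx2⟩, hx⟩ :=
          exists_eq_eta hα (n := n) (j := 2 * k + 1) (by omega) (by omega)
        have hx0 : 0 < x := (hd0 _ (by omega)).trans_lt hx1
        have hxπ : x < Real.pi := hx2.trans (d_lt_pi (by omega) (by omega))
        exact ⟨x, fun _ _ => hx1, fun _ _ => ⟨hx0.le, hx2.le⟩, fun _ _ _ => hx,
          fun _ _ => exists_eigenvector_sin hn hx0 hxπ
            (sin_eq_of_eq_eta hα (by omega) hx0 hxπ k hx)⟩
    · refine ⟨d n (2 * m + 1), fun _ _ => ?_, fun _ _ => ⟨hd0 _ (by omega), le_rfl⟩,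
        fun he _ _ => ?_, fun _ _ => exists_eigenvector_cos α hn (hd0 _ (by omega))
          (d_lt_pi (by omega) hjn) m ?_⟩
      · rw [Nat.add_sub_cancel, d_succ]
        linarith
      · exact absurd he (by simp)
      · rw [d]
        push_cast
        field_simp
        ring
  choose θ h1 h2 h3 h4 using key
  exact ⟨θ, h1, h2, h3, h4⟩

theorem invFunOn_eq_of_injOn {f : ℝ → ℝ} {t : Set ℝ} (hf : Set.InjOn f t) {x y : ℝ} (hx : x ∈ t)
    (hy : y = f x) : Function.invFunOn f t y = x := by
  subst hy
  exact hf (Function.invFunOn_mem ⟨x, hx, rfl⟩) hx (Function.invFunOn_eq ⟨x, hx, rfl⟩)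

end WeightedCycle

/-! ### Assembly -/

open WeightedCycle in
theorem mainTheorem2 (α : ℝ) (hα : α < 0) (n : ℕ) (hn : WeightedCycle.bigN α ≤ n) :
    (WeightedCycle.gMinus (WeightedCycle.s α n) = WeightedCycle.eigval α n 1 ∧
      WeightedCycle.s α n ∈ Set.Ioo 0 (WeightedCycle.omega α) ∧
      WeightedCycle.s α n = WeightedCycle.phi α n (WeightedCycle.s α n) ∧
      ∀ x ∈ Set.Ioo 0 (WeightedCycle.omega α),
        x = WeightedCycle.phi α n x → x = WeightedCycle.s α n) ∧
    ∀ j : ℕ, Even j → 4 ≤ j → j ≤ n →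
      (WeightedCycle.g (WeightedCycle.z α n j) = WeightedCycle.eigval α n j ∧
        WeightedCycle.z α n j ∈ Set.Icc 0 Real.pi ∧
        WeightedCycle.z α n j =
          WeightedCycle.d n j + WeightedCycle.eta α (WeightedCycle.z α n j) / n ∧
        ∀ x ∈ Set.Icc 0 Real.pi,
          x = WeightedCycle.d n j + WeightedCycle.eta α x / n → x = WeightedCycle.z α n j) := by
  have hn3 : 3 ≤ n := le_trans (le_max_left _ _) hn
  obtain ⟨y, hy, hyφ⟩ := exists_eq_phi hα hn
  obtain ⟨θ, hlow, hup, hθeq, hθev⟩ := exists_angles hα hn3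
  have hθmem : ∀ j, 2 ≤ j → j ≤ n → θ j ∈ Set.Icc 0 Real.pi := fun j h1 h2 =>
    ⟨(hup j h1 h2).1, (hup j h1 h2).2.trans (d_lt_pi (by omega) h2).le⟩
  have hg0 : ∀ x, 0 ≤ g x := fun x => by rw [g]; positivity
  set ν : ℕ → ℝ := fun j => if j = 1 then gMinus y else g (θ j) with hν
  have hν1 : ν 1 = gMinus y := if_pos rfl
  have hν2 : ∀ j, 2 ≤ j → ν j = g (θ j) := fun j hj => if_neg (by omega)
  have hmono : ∀ j k, 1 ≤ j → j < k → k ≤ n → ν j < ν k := by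
    intro j k h1 hjk hk
    rw [hν2 k (by omega)]
    rcases (by omega : j = 1 ∨ 2 ≤ j) with rfl | h2
    · rw [hν1]
      exact (gMinus_neg hy.1).trans_le (hg0 _)
    · rw [hν2 j h2]
      refine g_strictMonoOn (hθmem j h2 (by omega)) (hθmem k (by omega) hk) ?_
      exact ((hup j h2 (by omega)).2.trans (d_mono n (by omega))).trans_lt
        (hlow k (by omega) hk)
  have hev : ∀ j, 1 ≤ j → j ≤ n → ∃ v : Fin n → ℝ, v ≠ 0 ∧
      (lapMatrix α n).mulVec v = ν j • v := by
    intro j h1 hj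
    rcases (by omega : j = 1 ∨ 2 ≤ j) with rfl | h2
    · rw [hν1]
      exact exists_eigenvector_sinh hn3 hy.1 ((eq_phi_iff hα n y).1 hyφ)
    · rw [hν2 j h2]
      exact hθev j h2 hj
  have heig : ∀ j, 1 ≤ j → j ≤ n → eigval α n j = ν j := fun j h1 h2 =>
    eigval_eq_of_strictMono hmono hev h1 h2
  constructor
  · have hs : s α n = y := invFunOn_eq_of_injOn gMinus_injOn (Set.mem_Ici.2 hy.1.le)
      ((heig 1 le_rfl (by omega)).trans hν1)
    rw [hs]
    refine ⟨((heig 1 le_rfl (by omega)).trans hν1).symm, hy, hyφ, fun x hx hxφ => ?_⟩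
    -- A second solution would give a negative eigenvalue, and only `ν 1` is negative.
    obtain ⟨v, hv, hvx⟩ := exists_eigenvector_sinh hn3 hx.1 ((eq_phi_iff hα n x).1 hxφ)
    obtain ⟨k, h1, hk, hxk⟩ := exists_eq_of_mulVec_eq hmono hev hv hvx
    rcases (by omega : k = 1 ∨ 2 ≤ k) with rfl | h2
    · exact gMinus_injOn (Set.mem_Ici.2 hx.1.le) (Set.mem_Ici.2 hy.1.le) (hxk.trans hν1)
    · rw [hν2 k h2] at hxk
      linarith [gMinus_neg hx.1, hg0 (θ k)]
  · intro j hj h4 hjn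
    have hθj := hθmem j (by omega) hjn
    have hej := (heig j (by omega) hjn).trans (hν2 j (by omega))
    have hz : z α n j = θ j := invFunOn_eq_of_injOn g_strictMonoOn.injOn hθj hej
    rw [hz]
    refine ⟨hej.symm, hθj, hθeq j hj h4 hjn, fun x hx hxη => ?_⟩
    obtain ⟨m, rfl⟩ : ∃ m, j = 2 * m + 1 + 1 := by
      obtain ⟨r, rfl⟩ := hj
      exact ⟨r - 1, by omega⟩
    obtain ⟨hx1, hx2⟩ := mem_Ioo_of_eq_eta hα (by omega) hjn hx.1 hx.2 hxη
    have hd0 : 0 ≤ d n (2 * m + 1) := by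
      simpa [d] using d_mono n (show 1 ≤ 2 * m + 1 by omega)
    have hx0 : 0 < x := hd0.trans_lt hx1
    have hxπ : x < Real.pi := hx2.trans (d_lt_pi (by omega) hjn)
    obtain ⟨v, hv, hvx⟩ := exists_eigenvector_sin hn3 hx0 hxπ
      (sin_eq_of_eq_eta hα (by omega) hx0 hxπ m hxη)
    obtain ⟨k, h1, hk, hxk⟩ := exists_eq_of_mulVec_eq hmono hev hv hvx
    rcases (by omega : k = 1 ∨ 2 ≤ k) with rfl | h2
    · rw [hν1] at hxk
      linarith [gMinus_neg hy.1, hg0 x]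
    rw [hν2 k h2] at hxk
    have hxθ : x = θ k := g_strictMonoOn.injOn hx (hθmem k h2 hk) hxk
    -- Interlacing puts every other `θ k` outside the open grid interval containing `x`.
    rcases lt_trichotomy k (2 * m + 1 + 1) with h | h | h
    · have := (hup k h2 hk).2.trans (d_mono n (show k ≤ 2 * m + 1 by omega))
      linarith
    · rw [hxθ, h]
    · have := (d_mono n (show 2 * m + 1 + 1 ≤ k - 1 by omega)).trans_lt
        (hlow k (by omega) hk)
      linarith
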